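/- Let $\mathbf{k}$ be a commutative unital ring, $X$ a set and $\Omega$ a semigroup. *Trees.* Let $\mathcal T$ be the set of planar rooted trees with at least one vertex, in which the leaves and the root are drawn as edges, each angle between consecutive incoming edges of a vertex is decorated by an element of $X$, each internal edge has a type in $\Omega$, and each leaf edge has type $1\in\Omega^1$. Write $|$ for the tree without vertices. An element of $\mathcal T$ is written $T=(b_1\,x_1\,b_2\cdots x_m\,b_{m+1})$, $m\ge 0$, where $b_1,\dots,b_{m+1}$ are the incoming edges of its root vertex from left to right (each $b_i$ is a leaf, or an internal edge of some type $\alpha_i\in\Omega$ carrying a tree $T_i\in\mathcal T$) and $x_i\in X$ decorates the angle between $b_i$ and $b_{i+1}$. For $\omega\in\Omega$ let $B^+_\omega(T)$ be the tree whose root vertex has a single incoming edge, of type $\omega$ and carrying $T$; extend $B^+_\omega$ linearly to $\mathbf k\mathcal T$. The product $\diamond$ of weight $\lambda\in\mathbf k$ on $\mathbf k\mathcal T$ is bilinear and defined recursively, for $T$ as above and $U=(c_1\,y_1\cdots y_n\,c_{n+1})$, by $$T\diamond U=(b_1\,x_1\cdots x_m\;d\;y_1\,c_2\cdots y_n\,c_{n+1}),$$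 where $d=c_1$ if $b_{m+1}$ is a leaf, $d=b_{m+1}$ if $c_1$ is a leaf, and, if $b_{m+1}$ has type $\alpha$ and carries $S$ while $c_1$ has type $\beta$ and carries $V$, $d$ is the edge of type $\alpha\beta$ carrying $B^+_\alpha(S)\diamond V+S\diamond B^+_\beta(V)+\lambda\,S\diamond V$ (expanded linearly). *Binary trees.* Let $Y\subset\mathcal T$ be the set of trees all of whose vertices have exactly two incoming edges, and let $\mathbf kY$ be the free module on it. For $T^l,T^r\in Y\sqcup\{|\}$ write $T=T^l\vee_{x,(\alpha_1,\alpha_2)}T^r$ for the binary tree with root angle $x$ and root edges of types $\alpha_1,\alpha_2\in\Omega^1$ carrying $T^l,T^r$ (the type being $1$ exactly for a leaf edge). Bilinear operations $\prec_\omega,\succ_\omega$ on $\mathbf kY$ are defined recursively by $$T\prec_\omega U=T^l\vee_{x,(\alpha_1,\alpha_2\omega)}(T^r\prec_\omega U+T^r\succ_{\alpha_2}U),\qquad T\succ_\omega U=(T\prec_{\beta_1}U^l+T\succ_\omega U^l)\vee_{y,(\omega\beta_1,\beta_2)}U^r$$ for $T=T^l\vee_{x,(\alpha_1,\alpha_2)}T^r$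 and $U=U^l\vee_{y,(\beta_1,\beta_2)}U^r$, with the conventions $|\succ_\omega T=T\prec_\omega|=T$ and $|\prec_\omega T=T\succ_\omega|=0$ for $\omega\in\Omega^1$, $T\in Y$. *Algebras.* A Rota–Baxter family algebra of weight $\lambda$ is a unital associative $\mathbf k$-algebra $R$ with linear operators $(P_\omega)_{\omega\in\Omega}$ such that $P_\alpha(a)P_\beta(b)=P_{\alpha\beta}(P_\alpha(a)b+aP_\beta(b)+\lambda ab)$. A dendriform family algebra is a $\mathbf k$-module with bilinear operations $(\prec_\omega,\succ_\omega)_{\omega\in\Omega}$ such that $$(x\prec_\alpha y)\prec_\beta z=x\prec_{\alpha\beta}(y\prec_\beta z+y\succ_\alpha z),\quad (x\succ_\alpha y)\prec_\beta z=x\succ_\alpha(y\prec_\beta z),\quad (x\prec_\beta y+x\succ_\alpha y)\succ_{\alpha\beta}z=x\succ_\alpha(y\succ_\beta z).$$ **Theorem 3.4.** Take $\lambda=0$. Then $(\mathbf k\mathcal T,\diamond,(B^+_\omega)_{\omega\in\Omega})$, with the one-vertex one-leaf tree as unit and with the map sending $x\in X$ to the one-vertex two-leaf tree with angle $x$, is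 the free Rota–Baxter family algebra of weight $0$ on $X$; and $(\mathbf kY,(\prec_\omega,\succ_\omega)_{\omega\in\Omega})$, with the same map, is the free dendriform family algebra on $X$. Moreover $\mathbf k\mathcal T$ is a dendriform family algebra for the operations $a\prec'_\omega b=a\diamond B^+_\omega(b)$ and $a\succ'_\omega b=B^+_\omega(a)\diamond b$, and the free dendriform family algebra $\mathbf kY$ is a dendriform family subalgebra of it: the natural inclusion $\iota:\mathbf kY\to\mathbf k\mathcal T$ is injective, its image is the span of the binary trees, this span is closed under all $\prec'_\omega$ and $\succ'_\omega$, $\iota$ respects the generators $x\in X$, and for all $\omega\in\Omega$ and $a,b\in\mathbf kY$ $$\iota(a\prec_\omega b)=\iota(a)\diamond B^+_\omega(\iota(b)),\qquad \iota(a\succ_\omega b)=B^+_\omega(\iota(a))\diamond\iota(b).$$ -/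

import Mathlib

universe w

namespace FamilyTrees

/-- An incoming edge of a vertex, with what sits on top of it: either a leaf (the zero-vertex
tree `|`), or an internal edge of type `ω` that carries a tree `t`. A leaf carries no datum;
this is the convention that leaf edges have type `1 ∈ Ω¹` and internal edges a type in `Ω`. -/
inductive Branch (Ω : Type*) (T : Type*) where
  | leaf : Branch Ω T
  | edge (ω : Ω) (t : T) : Branch Ω T

/-- `X`-angularly decorated `Ω`-typed planar rooted trees (with at least one vertex). A tree is
given by the incoming edges of its root vertex, listed from left to right with the decorations of
the angles between consecutive ones: `b₁ x₁ b₂ x₂ … xₙ bₙ₊₁`, `n ≥ 0`. Here `last b` is the vertex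
with the single incoming edge `b`, and `cons b x T` puts a further incoming edge `b` to the left of
those of the root vertex of `T`, the new angle being decorated by `x`. -/
inductive PTree (X : Type*) (Ω : Type*) where
  | last (b : Branch Ω (PTree X Ω)) : PTree X Ω
  | cons (b : Branch Ω (PTree X Ω)) (x : X) (T : PTree X Ω) : PTree X Ω

/-- `X`-decorated `Ω`-typed planar binary trees with at least one vertex: the root vertex has a left
and a right incoming edge and one angle, decorated by `x`. -/
inductive BTree (X : Type*) (Ω : Type*) where
  | node (l : Branch Ω (BTree X Ω)) (x : X) (r : Branch Ω (BTree X Ω)) : BTree X Ω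

section Trees

variable {X Ω : Type*}

namespace PTree

/-- The leftmost incoming edge of the root vertex. -/
def firstBranch : PTree X Ω → Branch Ω (PTree X Ω)
  | last b => b
  | cons b _ _ => b

/-- The rightmost incoming edge of the root vertex. -/
def lastBranch : PTree X Ω → Branch Ω (PTree X Ω)
  | last b => b
  | cons _ _ T => T.lastBranch

/-- Replace the leftmost incoming edge of the root vertex by `b`. -/
def setFirst (b : Branch Ω (PTree X Ω)) : PTree X Ω → PTree X Ω
  | last _ => last b
  | cons _ x T => cons b x T

/-- For `T = b₁ x₁ … bₘ xₘ bₘ₊₁` and `U = c₁ y₁ c₂ … yₙ cₙ₊₁`, the tree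
`T.glue b U = b₁ x₁ … bₘ xₘ b y₁ c₂ … yₙ cₙ₊₁`, in which `b` takes the place both of the rightmost
edge of `T` and of the leftmost edge of `U`. -/
def glue : PTree X Ω → Branch Ω (PTree X Ω) → PTree X Ω → PTree X Ω
  | last _, b, U => U.setFirst b
  | cons c x T, b, U => cons c x (T.glue b U)

/-- The tree `B⁺_ω(T)`: a new root vertex whose only incoming edge has type `ω` and carries `T`. -/
def graft (ω : Ω) (T : PTree X Ω) : PTree X Ω := last (.edge ω T)

theorem size_first_lt {U V : PTree X Ω} {β : Ω} (h : U.firstBranch = .edge β V) :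
    sizeOf V < sizeOf (graft β V) ∧ sizeOf (graft β V) ≤ sizeOf U := by
  cases U <;> simp only [firstBranch] at h <;> subst h <;> simp [graft] <;> omega

theorem size_last_lt {T S : PTree X Ω} {α : Ω} (h : T.lastBranch = .edge α S) :
    sizeOf S < sizeOf (graft α S) ∧ sizeOf (graft α S) ≤ sizeOf T := by
  match T with
  | last b =>
    simp only [lastBranch] at h
    subst h
    simp [graft]
    omega
  | cons b x T =>
    simp only [lastBranch] at h
    have := size_last_lt h
    simp only [cons.sizeOf_spec]
    omega

mutual
/-- A tree is binary if each of its vertices has exactly two incoming edges. -/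
def IsBinary : PTree X Ω → Prop
  | cons b _ (last c) => BranchIsBinary b ∧ BranchIsBinary c
  | _ => False
/-- The tree that sits on top of an edge, if any, is binary. -/
def BranchIsBinary : Branch Ω (PTree X Ω) → Prop
  | .leaf => True
  | .edge _ T => IsBinary T
end

end PTree

mutual
/-- The natural inclusion of binary trees into planar rooted trees. -/
def BTree.toPTree : BTree X Ω → PTree X Ω
  | .node l x r => .cons (branchToPTree l) x (.last (branchToPTree r))
/-- The natural inclusion, on the incoming edges. -/
def branchToPTree : Branch Ω (BTree X Ω) → Branch Ω (PTree X Ω)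
  | .leaf => .leaf
  | .edge ω T => .edge ω T.toPTree
end

end Trees

noncomputable section Operations

variable (k : Type*) [CommRing k] {X Ω : Type*}

/-- The `k`-bilinear extension of a map given on pairs of basis elements. -/
def bilinExt {S T M : Type*} [AddCommGroup M] [Module k M] (f : S → T → M) :
    (S →₀ k) →ₗ[k] (T →₀ k) →ₗ[k] M :=
  Finsupp.linearCombination k fun s => Finsupp.linearCombination k (f s)

variable {k} in
/-- The product `T ⋄ U` of weight `lam` of two trees. If the rightmost edge of `T` or the leftmost
edge of `U` is a leaf, then `T` and `U` are joined at their roots, the two extreme edges being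
identified. If these edges are internal, of types `α` and `β`, with trees `S` and `V` on top,
they are replaced by one edge of type `αβ`, which carries
`B⁺_α(S) ⋄ V + S ⋄ B⁺_β(V) + lam (S ⋄ V)`. -/
def diamondTree [Semigroup Ω] (lam : k) (T U : PTree X Ω) : PTree X Ω →₀ k :=
  match _hT : T.lastBranch, _hU : U.firstBranch with
  | .leaf, c => Finsupp.single (T.glue c U) 1
  | .edge α S, .leaf => Finsupp.single (T.glue (.edge α S) U) 1
  | .edge α S, .edge β V =>
      (diamondTree lam (PTree.graft α S) V + diamondTree lam S (PTree.graft β V)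
        + lam • diamondTree lam S V).mapDomain fun W => T.glue (.edge (α * β) W) U
termination_by sizeOf T + sizeOf U
decreasing_by
  all_goals
    have h1 := PTree.size_last_lt _hT
    have h2 := PTree.size_first_lt _hU
    omega

/-- The bilinear product `⋄` of weight `lam` on `k𝒯`. -/
def diamond [Semigroup Ω] (lam : k) :
    (PTree X Ω →₀ k) →ₗ[k] (PTree X Ω →₀ k) →ₗ[k] (PTree X Ω →₀ k) :=
  bilinExt k (diamondTree lam)

/-- The linear operator `B⁺_ω` on `k𝒯`. -/
def Bplus (ω : Ω) : (PTree X Ω →₀ k) →ₗ[k] (PTree X Ω →₀ k) :=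
  Finsupp.lmapDomain k k (PTree.graft ω)

/-- The tree with one vertex and one leaf. -/
def unitTree : PTree X Ω →₀ k := Finsupp.single (.last .leaf) 1

/-- The tree with one vertex and two leaves, whose angle is decorated by `x`, as an element
of `k𝒯`. -/
def genTree (x : X) : PTree X Ω →₀ k := Finsupp.single (.cons .leaf x (.last .leaf)) 1

/-- The tree with one vertex and two leaves, whose angle is decorated by `x`, as an element of the
span of the binary trees. -/
def genBTree (x : X) : BTree X Ω →₀ k := Finsupp.single (.node .leaf x .leaf) 1

/- The recursive operations on binary trees. For `T = Tˡ ∨_{x,(α₁,α₂)} Tʳ` and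
`U = Uˡ ∨_{y,(β₁,β₂)} Uʳ`,
`T ≺_ω U = Tˡ ∨_{x,(α₁,α₂ω)} (Tʳ ≺_ω U + Tʳ ≻_{α₂} U)` and
`T ≻_ω U = (T ≺_{β₁} Uˡ + T ≻_ω Uˡ) ∨_{y,(ωβ₁,β₂)} Uʳ`.
If `Tʳ = |`, then `α₂ = 1`, `| ≺_ω U = 0` and `| ≻_1 U = U`, so that
`T ≺_ω U = Tˡ ∨_{x,(α₁,ω)} U`; if `Uˡ = |`, then `β₁ = 1`, `T ≺_1 | = T` and `T ≻_ω | = 0`, so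
that `T ≻_ω U = T ∨_{y,(ω,β₂)} Uʳ`. -/
mutual
/-- The operation `≺_ω` on binary trees. -/
def precTree [Semigroup Ω] (ω : Ω) : BTree X Ω → BTree X Ω → (BTree X Ω →₀ k)
  | .node l x .leaf, U => Finsupp.single (.node l x (.edge ω U)) 1
  | .node l x (.edge α R), U =>
      (precTree ω R U + succTree α R U).mapDomain fun W => .node l x (.edge (α * ω) W)
termination_by T U => sizeOf T + sizeOf U
/-- The operation `≻_ω` on binary trees. -/
def succTree [Semigroup Ω] (ω : Ω) : BTree X Ω → BTree X Ω → (BTree X Ω →₀ k)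
  | T, .node .leaf y r => Finsupp.single (.node (.edge ω T) y r) 1
  | T, .node (.edge β L) y r =>
      (precTree β T L + succTree ω T L).mapDomain fun W => .node (.edge (ω * β) W) y r
termination_by T U => sizeOf T + sizeOf U
end

/-- The bilinear operation `≺_ω` on the span of the binary trees. -/
def prec [Semigroup Ω] (ω : Ω) :
    (BTree X Ω →₀ k) →ₗ[k] (BTree X Ω →₀ k) →ₗ[k] (BTree X Ω →₀ k) :=
  bilinExt k (precTree k ω)

/-- The bilinear operation `≻_ω` on the span of the binary trees. -/
def succ [Semigroup Ω] (ω : Ω) :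
    (BTree X Ω →₀ k) →ₗ[k] (BTree X Ω →₀ k) →ₗ[k] (BTree X Ω →₀ k) :=
  bilinExt k (succTree k ω)

/-- The linear extension of the natural inclusion of binary trees. -/
def incl : (BTree X Ω →₀ k) →ₗ[k] (PTree X Ω →₀ k) :=
  Finsupp.lmapDomain k k BTree.toPTree

variable (X Ω) in
/-- The submodule of `k𝒯` spanned by the binary trees. -/
def binarySpan : Submodule k (PTree X Ω →₀ k) :=
  Submodule.span k ((fun T => Finsupp.single T 1) '' {T : PTree X Ω | T.IsBinary})

/-- The operation `a ≺'_ω b = a ⋆ P_ω(b)` induced by a product and a family of operators. -/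
def inducedPrec {R : Type*} [AddCommGroup R] [Module k R]
    (mul : R →ₗ[k] R →ₗ[k] R) (P : Ω → R →ₗ[k] R) (ω : Ω) : R →ₗ[k] R →ₗ[k] R :=
  mul.compl₂ (P ω)

/-- The operation `a ≻'_ω b = P_ω(a) ⋆ b` induced by a product and a family of operators. -/
def inducedSucc {R : Type*} [AddCommGroup R] [Module k R]
    (mul : R →ₗ[k] R →ₗ[k] R) (P : Ω → R →ₗ[k] R) (ω : Ω) : R →ₗ[k] R →ₗ[k] R :=
  mul ∘ₗ P ω

end Operations

section Algebras

variable {k : Type*} [CommRing k] {X Ω : Type*} [Semigroup Ω]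

/-- `R`, with the bilinear product `mul`, the unit `one` and the operators `P`, is a (unital,
associative) Rota–Baxter family algebra of weight `lam`. -/
structure IsRotaBaxterFamilyAlgebra {R : Type*} [AddCommGroup R] [Module k R] (lam : k)
    (mul : R →ₗ[k] R →ₗ[k] R) (one : R) (P : Ω → R →ₗ[k] R) : Prop where
  assoc : ∀ a b c, mul (mul a b) c = mul a (mul b c)
  one_mul : ∀ a, mul one a = a
  mul_one : ∀ a, mul a one = a
  rota_baxter : ∀ α β a b,
    mul (P α a) (P β b) = P (α * β) (mul (P α a) b + mul a (P β b) + lam • mul a b)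

/-- `R`, with the map `j`, is a free Rota–Baxter family algebra of weight `lam` on `X`. -/
def IsFreeRotaBaxterFamilyAlgebra {R : Type*} [AddCommGroup R] [Module k R] (lam : k)
    (mul : R →ₗ[k] R →ₗ[k] R) (one : R) (P : Ω → R →ₗ[k] R) (j : X → R) : Prop :=
  IsRotaBaxterFamilyAlgebra lam mul one P ∧
  ∀ (A : Type w) [AddCommGroup A] [Module k A] (mul' : A →ₗ[k] A →ₗ[k] A) (one' : A)
    (P' : Ω → A →ₗ[k] A), IsRotaBaxterFamilyAlgebra lam mul' one' P' →
    ∀ f : X → A, ∃! F : R →ₗ[k] A,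
      F one = one' ∧ (∀ a b, F (mul a b) = mul' (F a) (F b)) ∧
      (∀ ω a, F (P ω a) = P' ω (F a)) ∧ ∀ x, F (j x) = f x

/-- `D`, with the bilinear operations `≺_ω = prec ω` and `≻_ω = succ ω`, is a dendriform family
algebra. -/
structure IsDendriformFamilyAlgebra {D : Type*} [AddCommGroup D] [Module k D]
    (prec succ : Ω → D →ₗ[k] D →ₗ[k] D) : Prop where
  prec_prec : ∀ α β x y z,
    prec β (prec α x y) z = prec (α * β) x (prec β y z + succ α y z)
  succ_prec : ∀ α β x y z,
    prec β (succ α x y) z = succ α x (prec β y z)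
  succ_succ : ∀ α β x y z,
    succ (α * β) (prec β x y + succ α x y) z = succ α x (succ β y z)

/-- A linear map compatible with the dendriform family operations. -/
structure IsDendriformFamilyHom {D E : Type*} [AddCommGroup D] [Module k D] [AddCommGroup E]
    [Module k E] (prec succ : Ω → D →ₗ[k] D →ₗ[k] D) (prec' succ' : Ω → E →ₗ[k] E →ₗ[k] E)
    (F : D →ₗ[k] E) : Prop where
  map_prec : ∀ ω a b, F (prec ω a b) = prec' ω (F a) (F b)
  map_succ : ∀ ω a b, F (succ ω a b) = succ' ω (F a) (F b)

/-- `D`, with the map `j`, is a free dendriform family algebra on `X`. -/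
def IsFreeDendriformFamilyAlgebra {D : Type*} [AddCommGroup D] [Module k D]
    (prec succ : Ω → D →ₗ[k] D →ₗ[k] D) (j : X → D) : Prop :=
  IsDendriformFamilyAlgebra prec succ ∧
  ∀ (E : Type w) [AddCommGroup E] [Module k E] (prec' succ' : Ω → E →ₗ[k] E →ₗ[k] E),
    IsDendriformFamilyAlgebra prec' succ' →
    ∀ f : X → E, ∃! F : D →ₗ[k] E,
      IsDendriformFamilyHom prec succ prec' succ' F ∧ ∀ x, F (j x) = f x

/-- A submodule of a dendriform family algebra that is stable under all the operations. -/
structure IsDendriformFamilySubalgebra {E : Type*} [AddCommGroup E] [Module k E]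
    (prec succ : Ω → E →ₗ[k] E →ₗ[k] E) (S : Submodule k E) : Prop where
  isDendriform : IsDendriformFamilyAlgebra prec succ
  prec_mem : ∀ ω, ∀ a ∈ S, ∀ b ∈ S, prec ω a b ∈ S
  succ_mem : ∀ ω, ∀ a ∈ S, ∀ b ∈ S, succ ω a b ∈ S

end Algebras

end FamilyTrees

/-! The product `T ⋄ U` changes only the rightmost root edge of `T` and the leftmost one of `U`.
Hence it commutes with joining trees along a new angle `x`:
`(a ∨ₓ b) ⋄ c = a ∨ₓ (b ⋄ c)` and `a ⋄ (b ∨ₓ c) = (a ⋄ b) ∨ₓ c`. As every tree is a join of unit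
trees and of trees `B⁺_ω(S)`, an identity between products follows by induction on the size from
the case where all factors are of the form `B⁺_ω(S)`, in which the Rota–Baxter identity applies.
Also `a ∨ₓ b = a ⋄ x ⋄ b`, so the value of a tree in any Rota–Baxter family algebra is forced by
the values of the generators.

A binary tree satisfies `Tˡ ∨ Tʳ = (Tˡ ∨ |) ≺ Tʳ = Tˡ ≻ (| ∨ Tʳ)`. A linear map from `kY` to a
dendriform family algebra that respects these two decompositions respects all products, since the
recursion for `≺` and `≻` is the first and the third dendriform axiom. This applies to the
evaluation of trees, and to the inclusion into `k𝒯` with the operations induced by `⋄` and `B⁺`;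
the latter being injective, `kY` inherits the dendriform axioms from `k𝒯`. -/

namespace FamilyTrees

noncomputable section

section Basis

variable {k : Type*} [CommRing k] {S T U M N P Q : Type*}
  [AddCommGroup M] [Module k M] [AddCommGroup N] [Module k N]
  [AddCommGroup P] [Module k P] [AddCommGroup Q] [Module k Q]

theorem ext_single {f g : (S →₀ k) →ₗ[k] M}
    (h : ∀ s, f (Finsupp.single s 1) = g (Finsupp.single s 1)) : f = g :=
  Finsupp.lhom_ext' fun s => LinearMap.ext_ring (h s)

theorem ext_single₂ {f g : (S →₀ k) →ₗ[k] (T →₀ k) →ₗ[k] M}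
    (h : ∀ s t, f (Finsupp.single s 1) (Finsupp.single t 1) =
      g (Finsupp.single s 1) (Finsupp.single t 1)) : f = g :=
  ext_single fun s => ext_single (h s)

theorem map_bilin_of_single {f : (S →₀ k) →ₗ[k] (T →₀ k) →ₗ[k] M} {F : M →ₗ[k] Q}
    {g : N →ₗ[k] P →ₗ[k] Q} {G : (S →₀ k) →ₗ[k] N} {H : (T →₀ k) →ₗ[k] P}
    (h : ∀ s t, F (f (Finsupp.single s 1) (Finsupp.single t 1)) =
      g (G (Finsupp.single s 1)) (H (Finsupp.single t 1)))
    (a : S →₀ k) (b : T →₀ k) : F (f a b) = g (G a) (H b) :=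
  LinearMap.congr_fun₂ (f := f.compr₂ F) (g := g.compl₁₂ G H) (ext_single₂ h) a b

theorem mixed_assoc_of_single {f : (S →₀ k) →ₗ[k] (T →₀ k) →ₗ[k] M}
    {g : M →ₗ[k] (U →₀ k) →ₗ[k] Q} {f' : (T →₀ k) →ₗ[k] (U →₀ k) →ₗ[k] N}
    {g' : (S →₀ k) →ₗ[k] N →ₗ[k] Q}
    (h : ∀ s t u, g (f (Finsupp.single s 1) (Finsupp.single t 1)) (Finsupp.single u 1) =
      g' (Finsupp.single s 1) (f' (Finsupp.single t 1) (Finsupp.single u 1)))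
    (a : S →₀ k) (b : T →₀ k) (c : U →₀ k) : g (f a b) c = g' a (f' b c) := by
  have trilinear : f.compr₂ g = (LinearMap.llcomp k _ _ _ ∘ₗ g').compl₂ f' :=
    ext_single₂ fun s t => ext_single (h s t)
  exact LinearMap.congr_fun (LinearMap.congr_fun₂ trilinear a b) c

@[simp]
theorem bilinExt_single (f : S → T → M) (s : S) (t : T) :
    bilinExt k f (Finsupp.single s 1) (Finsupp.single t 1) = f s t := by
  simp [bilinExt]

end Basis

section RotaBaxter

variable {k : Type*} [CommRing k] {Ω : Type*} [Semigroup Ω] {R : Type*} [AddCommGroup R]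
  [Module k R] {mul : R →ₗ[k] R →ₗ[k] R} {P : Ω → R →ₗ[k] R}

/-- The product `mul` is associative at the triple `(a, b, c)`; this names the instances of
associativity that occur in inductions. -/
def AssocAt (mul : R →ₗ[k] R →ₗ[k] R) (a b c : R) : Prop :=
  mul (mul a b) c = mul a (mul b c)

theorem AssocAt.of_rotaBaxter {lam : k}
    (rota_baxter : ∀ α β a b,
      mul (P α a) (P β b) = P (α * β) (mul (P α a) b + mul a (P β b) + lam • mul a b))
    {α β γ : Ω} {a b c : R}
    (h₁ : AssocAt mul (P α a) (P β b) c) (h₂ : AssocAt mul (P α a) b (P γ c))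
    (h₃ : AssocAt mul a (P β b) (P γ c)) (h₄ : AssocAt mul (P α a) b c)
    (h₅ : AssocAt mul a (P β b) c) (h₆ : AssocAt mul a b (P γ c)) (h₇ : AssocAt mul a b c) :
    AssocAt mul (P α a) (P β b) (P γ c) := by
  unfold AssocAt at *
  have left := rota_baxter (α * β) γ (mul (P α a) b + mul a (P β b) + lam • mul a b) c
  have right := rota_baxter α (β * γ) a (mul (P β b) c + mul b (P γ c) + lam • mul b c)
  rw [← rota_baxter] at left right
  rw [left, right, mul_assoc]
  congr 1
  simp only [map_add, map_smul, LinearMap.add_apply, LinearMap.smul_apply, smul_add,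
    h₁, h₂, h₃, h₄, h₅, h₆, h₇]
  abel

theorem IsRotaBaxterFamilyAlgebra.isDendriformFamilyAlgebra {one : R}
    (h : IsRotaBaxterFamilyAlgebra (0 : k) mul one P) :
    IsDendriformFamilyAlgebra (inducedPrec k mul P) (inducedSucc k mul P) where
  prec_prec α β x y z := by
    simp [inducedPrec, inducedSucc, h.assoc, h.rota_baxter, add_comm]
  succ_prec α β x y z := by
    simp [inducedPrec, inducedSucc, h.assoc]
  succ_succ α β x y z := by
    simp [inducedPrec, inducedSucc, ← h.assoc, h.rota_baxter α β x y, add_comm]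

end RotaBaxter

section Dendriform

variable {k : Type*} [CommRing k] {Ω : Type*} [Semigroup Ω] {D E : Type*} [AddCommGroup D]
  [Module k D] [AddCommGroup E] [Module k E] {p s : Ω → D →ₗ[k] D →ₗ[k] D}
  {p' s' : Ω → E →ₗ[k] E →ₗ[k] E} {F : D →ₗ[k] E}

theorem IsDendriformFamilyAlgebra.of_injective (h : IsDendriformFamilyAlgebra p' s')
    (hF : Function.Injective F) (hom : IsDendriformFamilyHom p s p' s' F) :
    IsDendriformFamilyAlgebra p s where
  prec_prec α β x y z := hF (by simp only [hom.map_prec, hom.map_succ, map_add, h.prec_prec])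
  succ_prec α β x y z := hF (by simp only [hom.map_prec, hom.map_succ, h.succ_prec])
  succ_succ α β x y z := hF (by
    rw [hom.map_succ, map_add, hom.map_prec, hom.map_succ, h.succ_succ, hom.map_succ,
      hom.map_succ])

theorem IsDendriformFamilyHom.isDendriformFamilySubalgebra_range
    (hom : IsDendriformFamilyHom p s p' s' F) (h : IsDendriformFamilyAlgebra p' s') :
    IsDendriformFamilySubalgebra p' s' (LinearMap.range F) where
  isDendriform := h
  prec_mem ω := by
    rintro _ ⟨a, rfl⟩ _ ⟨b, rfl⟩
    exact ⟨p ω a b, hom.map_prec ω a b⟩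
  succ_mem ω := by
    rintro _ ⟨a, rfl⟩ _ ⟨b, rfl⟩
    exact ⟨s ω a b, hom.map_succ ω a b⟩

end Dendriform

section Trees

variable {X Ω : Type*}

namespace PTree

theorem induction_on {p : PTree X Ω → Prop} (T : PTree X Ω) (leaf : p (last .leaf))
    (graft : ∀ ω T, p T → p (graft ω T))
    (cons : ∀ b x T, p (last b) → p T → p (cons b x T)) : p T :=
  match T with
  | .last .leaf => leaf
  | .last (.edge ω T) => graft ω T (induction_on T leaf graft cons)
  | .cons .leaf x T => cons _ x T leaf (induction_on T leaf graft cons)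
  | .cons (.edge ω S) x T =>
      cons _ x T (graft ω S (induction_on S leaf graft cons)) (induction_on T leaf graft cons)

@[simp]
theorem sizeOf_pos (T : PTree X Ω) : 0 < sizeOf T := by
  cases T <;> simp

/-- `T.join x U` is the tree whose root vertex has the incoming edges of that of `T` followed by
those of that of `U`, with a new angle decorated by `x` in between. -/
def join (x : X) : PTree X Ω → PTree X Ω → PTree X Ω
  | last b, U => cons b x U
  | cons b y T, U => cons b y (T.join x U)

@[simp]
theorem lastBranch_join (x : X) (T U : PTree X Ω) :
    (T.join x U).lastBranch = U.lastBranch := by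
  induction T using induction_on with
  | leaf => rfl
  | graft => rfl
  | cons _ _ _ _ ih => exact ih

@[simp]
theorem firstBranch_join (x : X) (T U : PTree X Ω) :
    (T.join x U).firstBranch = T.firstBranch := by
  cases T <;> rfl

theorem join_glue (x : X) (T U W : PTree X Ω) (d : Branch Ω (PTree X Ω)) :
    (T.join x U).glue d W = T.join x (U.glue d W) := by
  induction T using induction_on with
  | leaf => rfl
  | graft => rfl
  | cons _ _ _ _ ih => simp only [join, glue, ih]

theorem glue_join (x : X) (T U W : PTree X Ω) (d : Branch Ω (PTree X Ω)) :
    T.glue d (U.join x W) = (T.glue d U).join x W := by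
  induction T using induction_on with
  | leaf => cases U <;> rfl
  | graft => cases U <;> rfl
  | cons _ _ _ _ ih => simp only [join, glue, ih]

theorem glue_lastBranch (T : PTree X Ω) (b : Branch Ω (PTree X Ω)) :
    T.glue T.lastBranch (last b) = T := by
  induction T using induction_on with
  | leaf => rfl
  | graft => rfl
  | cons _ _ _ _ ih => simp only [lastBranch, glue, ih]

theorem setFirst_firstBranch (T : PTree X Ω) : T.setFirst T.firstBranch = T := by
  cases T <;> rfl

end PTree

@[simp]
theorem BTree.sizeOf_pos (T : BTree X Ω) : 0 < sizeOf T := by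
  cases T
  simp

theorem BTree.induction_on {p : BTree X Ω → Prop} (T : BTree X Ω)
    (gen : ∀ x, p (.node .leaf x .leaf))
    (left : ∀ α L x, p L → p (.node (.edge α L) x .leaf))
    (right : ∀ l x β R, p (.node l x .leaf) → p R → p (.node l x (.edge β R))) : p T :=
  match T with
  | .node .leaf x .leaf => gen x
  | .node (.edge α L) x .leaf => left α L x (induction_on L gen left right)
  | .node .leaf x (.edge β R) => right _ x β R (gen x) (induction_on R gen left right)
  | .node (.edge α L) x (.edge β R) =>
      right _ x β R (left α L x (induction_on L gen left right)) (induction_on R gen left right)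

mutual
theorem BTree.toPTree_injective : ∀ {T U : BTree X Ω}, T.toPTree = U.toPTree → T = U
  | .node l x r, .node l' x' r', h => by
    simp only [BTree.toPTree, PTree.cons.injEq, PTree.last.injEq] at h
    obtain ⟨hl, rfl, hr⟩ := h
    rw [branchToPTree_injective hl, branchToPTree_injective hr]
theorem branchToPTree_injective :
    ∀ {b c : Branch Ω (BTree X Ω)}, branchToPTree b = branchToPTree c → b = c
  | .leaf, .leaf, _ => rfl
  | .leaf, .edge _ _, h => by simp [branchToPTree] at h
  | .edge _ _, .leaf, h => by simp [branchToPTree] at h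
  | .edge _ T, .edge _ U, h => by
    simp only [branchToPTree, Branch.edge.injEq] at h
    rw [h.1, BTree.toPTree_injective h.2]
end

theorem BTree.isBinary_toPTree (T : BTree X Ω) : T.toPTree.IsBinary := by
  induction T using induction_on with
  | gen => simp [toPTree, branchToPTree, PTree.IsBinary, PTree.BranchIsBinary]
  | left _ _ _ ihL =>
    simpa [toPTree, branchToPTree, PTree.IsBinary, PTree.BranchIsBinary] using ihL
  | right _ _ _ _ ihl ihR =>
    simp_all [toPTree, branchToPTree, PTree.IsBinary, PTree.BranchIsBinary]

mutual
theorem PTree.IsBinary.exists_toPTree :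
    ∀ {T : PTree X Ω}, T.IsBinary → ∃ S : BTree X Ω, S.toPTree = T
  | .cons b x (.last c), h => by
    simp only [PTree.IsBinary] at h
    obtain ⟨l, rfl⟩ := PTree.BranchIsBinary.exists_branchToPTree h.1
    obtain ⟨r, rfl⟩ := PTree.BranchIsBinary.exists_branchToPTree h.2
    exact ⟨.node l x r, by simp [BTree.toPTree]⟩
  | .last _, h => by simp [PTree.IsBinary] at h
  | .cons _ _ (.cons _ _ _), h => by simp [PTree.IsBinary] at h
theorem PTree.BranchIsBinary.exists_branchToPTree :
    ∀ {b : Branch Ω (PTree X Ω)}, PTree.BranchIsBinary b →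
      ∃ c : Branch Ω (BTree X Ω), branchToPTree c = b
  | .leaf, _ => ⟨.leaf, by simp [branchToPTree]⟩
  | .edge ω T, h => by
    simp only [PTree.BranchIsBinary] at h
    obtain ⟨S, rfl⟩ := PTree.IsBinary.exists_toPTree h
    exact ⟨.edge ω S, by simp [branchToPTree]⟩
end

theorem BTree.range_toPTree :
    Set.range (toPTree : BTree X Ω → PTree X Ω) = {T | T.IsBinary} :=
  Set.Subset.antisymm (Set.range_subset_iff.2 isBinary_toPTree)
    fun _ hT => PTree.IsBinary.exists_toPTree hT

end Trees

section Diamond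

variable {k : Type*} [CommRing k] {X Ω : Type*}

/-- The bilinear extension of `PTree.join x` to `k𝒯`. -/
def joinₗ (x : X) : (PTree X Ω →₀ k) →ₗ[k] (PTree X Ω →₀ k) →ₗ[k] (PTree X Ω →₀ k) :=
  bilinExt k fun T U => Finsupp.single (T.join x U) 1

@[simp]
theorem joinₗ_single (x : X) (T U : PTree X Ω) :
    joinₗ x (Finsupp.single T (1 : k)) (Finsupp.single U 1) = Finsupp.single (T.join x U) 1 := by
  simp [joinₗ]

theorem joinₗ_single_left (x : X) (T : PTree X Ω) (u : PTree X Ω →₀ k) :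
    joinₗ x (Finsupp.single T 1) u = u.mapDomain (T.join x) :=
  LinearMap.congr_fun (g := Finsupp.lmapDomain k k (T.join x)) (ext_single (by simp)) u

theorem joinₗ_single_right (x : X) (u : PTree X Ω →₀ k) (W : PTree X Ω) :
    joinₗ x u (Finsupp.single W 1) = u.mapDomain fun T => T.join x W :=
  LinearMap.congr_fun (f := (joinₗ x).flip (Finsupp.single W 1))
    (g := Finsupp.lmapDomain k k fun T => T.join x W) (ext_single (by simp)) u

@[simp]
theorem Bplus_single (ω : Ω) (T : PTree X Ω) :
    Bplus k ω (Finsupp.single T 1) = Finsupp.single (T.graft ω) 1 := by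
  simp [Bplus]

theorem single_cons (b : Branch Ω (PTree X Ω)) (x : X) (T : PTree X Ω) :
    Finsupp.single (PTree.cons b x T) (1 : k) =
      joinₗ x (Finsupp.single (.last b) 1) (Finsupp.single T 1) :=
  (joinₗ_single x (.last b) T).symm

theorem single_last_edge (ω : Ω) (T : PTree X Ω) :
    Finsupp.single (PTree.last (.edge ω T)) (1 : k) = Bplus k ω (Finsupp.single T 1) :=
  (Bplus_single ω T).symm

theorem single_last_leaf : Finsupp.single (PTree.last (.leaf : Branch Ω (PTree X Ω))) (1 : k) =
    unitTree k := rfl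

variable [Semigroup Ω] (lam : k)

local notation:70 a:70 " ⋄ " b:71 => diamond k lam a b

/-- The edge `d` in `T ⋄ U`, as a combination of edges, in terms of the rightmost root edge of `T`
and the leftmost root edge of `U`. -/
def branchMul : Branch Ω (PTree X Ω) → Branch Ω (PTree X Ω) → (Branch Ω (PTree X Ω) →₀ k)
  | .leaf, c => Finsupp.single c 1
  | .edge α S, .leaf => Finsupp.single (.edge α S) 1
  | .edge α S, .edge β V =>
      (diamondTree lam (PTree.graft α S) V + diamondTree lam S (PTree.graft β V)
        + lam • diamondTree lam S V).mapDomain (.edge (α * β))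

theorem branchMul_leaf (b : Branch Ω (PTree X Ω)) :
    branchMul lam b .leaf = Finsupp.single b 1 := by
  cases b <;> rfl

theorem diamondTree_eq_mapDomain (T U : PTree X Ω) :
    diamondTree lam T U =
      (branchMul lam T.lastBranch U.firstBranch).mapDomain fun d => T.glue d U := by
  rw [diamondTree]
  split <;> simp only [branchMul, Finsupp.mapDomain_single, *]
  rw [← Finsupp.mapDomain_comp]
  rfl

@[simp]
theorem diamond_single (T U : PTree X Ω) :
    Finsupp.single T 1 ⋄ Finsupp.single U 1 = diamondTree lam T U := by
  simp [diamond]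

theorem diamond_joinₗ_left (x : X) (a b c : PTree X Ω →₀ k) :
    joinₗ x a b ⋄ c = joinₗ x a (b ⋄ c) := by
  refine mixed_assoc_of_single (fun T U W => ?_) a b c
  rw [joinₗ_single, diamond_single, diamond_single, joinₗ_single_left]
  simp only [diamondTree_eq_mapDomain, ← Finsupp.mapDomain_comp, PTree.lastBranch_join,
    PTree.join_glue, Function.comp_def]

theorem diamond_joinₗ_right (x : X) (a b c : PTree X Ω →₀ k) :
    a ⋄ joinₗ x b c = joinₗ x (a ⋄ b) c := by
  refine (mixed_assoc_of_single (fun T U W => ?_) a b c).symm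
  rw [joinₗ_single, diamond_single, diamond_single, joinₗ_single_right]
  simp only [diamondTree_eq_mapDomain, ← Finsupp.mapDomain_comp, PTree.firstBranch_join,
    PTree.glue_join, Function.comp_def]

theorem unitTree_diamond (a : PTree X Ω →₀ k) : unitTree k ⋄ a = a := by
  refine LinearMap.congr_fun (g := LinearMap.id) (ext_single fun T => ?_) a
  simp [unitTree, diamondTree_eq_mapDomain, PTree.lastBranch, branchMul, PTree.glue,
    PTree.setFirst_firstBranch]

theorem diamond_unitTree (a : PTree X Ω →₀ k) : a ⋄ unitTree k = a := by
  refine LinearMap.congr_fun (f := (diamond k lam).flip (unitTree k)) (g := LinearMap.id)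
    (ext_single fun T => ?_) a
  simp [unitTree, diamondTree_eq_mapDomain, PTree.firstBranch, branchMul_leaf,
    PTree.glue_lastBranch]

theorem Bplus_diamond_Bplus (α β : Ω) (a b : PTree X Ω →₀ k) :
    Bplus k α a ⋄ Bplus k β b =
      Bplus k (α * β) (Bplus k α a ⋄ b + a ⋄ Bplus k β b + lam • (a ⋄ b)) := by
  refine LinearMap.congr_fun₂ (f := (diamond k lam).compl₁₂ (Bplus k α) (Bplus k β))
    (g := (diamond k lam ∘ₗ Bplus k α + (diamond k lam).compl₂ (Bplus k β) +
      lam • diamond k lam).compr₂ (Bplus k (α * β))) (ext_single₂ fun S V => ?_) a b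
  have edges : diamondTree lam (S.graft α) (V.graft β) =
      Bplus k (α * β) (diamondTree lam (S.graft α) V + diamondTree lam S (V.graft β) +
        lam • diamondTree lam S V) := by
    rw [diamondTree_eq_mapDomain]
    simp only [PTree.graft, PTree.lastBranch, PTree.firstBranch, branchMul,
      ← Finsupp.mapDomain_comp]
    rfl
  simpa using edges

theorem diamond_assoc_single (T U W : PTree X Ω) :
    AssocAt (diamond k lam) (Finsupp.single T 1) (Finsupp.single U 1) (Finsupp.single W 1) := by
  match T, U, W with
  | .cons b x T, U, W =>
    have ih : (_ ⋄ _) ⋄ _ = _ ⋄ (_ ⋄ _) := diamond_assoc_single T U W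
    simp only [AssocAt, single_cons, diamond_joinₗ_left, ih]
  | T, .cons b x U, W =>
    simp only [AssocAt, single_cons, diamond_joinₗ_left, diamond_joinₗ_right]
  | T, U, .cons b x W =>
    have ih : (_ ⋄ _) ⋄ _ = _ ⋄ (_ ⋄ _) := diamond_assoc_single T U (.last b)
    simp only [AssocAt, single_cons, diamond_joinₗ_right, ih]
  | .last .leaf, U, W => simp only [AssocAt, single_last_leaf, unitTree_diamond]
  | T, .last .leaf, W =>
    simp only [AssocAt, single_last_leaf, unitTree_diamond, diamond_unitTree]
  | T, U, .last .leaf => simp only [AssocAt, single_last_leaf, diamond_unitTree]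
  | .last (.edge α S), .last (.edge β V), .last (.edge γ W) =>
    have h₁ := diamond_assoc_single (.last (.edge α S)) (.last (.edge β V)) W
    have h₂ := diamond_assoc_single (.last (.edge α S)) V (.last (.edge γ W))
    have h₃ := diamond_assoc_single S (.last (.edge β V)) (.last (.edge γ W))
    have h₄ := diamond_assoc_single (.last (.edge α S)) V W
    have h₅ := diamond_assoc_single S (.last (.edge β V)) W
    have h₆ := diamond_assoc_single S V (.last (.edge γ W))
    have h₇ := diamond_assoc_single S V W
    simp only [single_last_edge] at *
    exact .of_rotaBaxter (Bplus_diamond_Bplus lam) h₁ h₂ h₃ h₄ h₅ h₆ h₇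
termination_by sizeOf T + sizeOf U + sizeOf W
decreasing_by all_goals (simp; try omega)

theorem isRotaBaxterFamilyAlgebra_diamond :
    IsRotaBaxterFamilyAlgebra lam (diamond k (X := X) (Ω := Ω) lam) (unitTree k) (Bplus k) where
  assoc := mixed_assoc_of_single (diamond_assoc_single lam)
  one_mul := unitTree_diamond lam
  mul_one := diamond_unitTree lam
  rota_baxter := Bplus_diamond_Bplus lam

theorem joinₗ_eq_diamond (x : X) (a b : PTree X Ω →₀ k) :
    joinₗ x a b = (a ⋄ genTree k x) ⋄ b := by
  rw [genTree, single_cons, single_last_leaf, diamond_joinₗ_right, diamond_joinₗ_left,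
    diamond_unitTree, unitTree_diamond]

end Diamond

section FreeRotaBaxter

variable {k : Type*} [CommRing k] {X Ω : Type*} {A : Type*} [AddCommGroup A] [Module k A]
  (mul : A →ₗ[k] A →ₗ[k] A) (one : A) (P : Ω → A →ₗ[k] A) (f : X → A)

mutual
/-- The value of a tree in an algebra with operators, for given values of the angle decorations. -/
def PTree.eval : PTree X Ω → A
  | .last b => evalBranch b
  | .cons b x T => mul (mul (evalBranch b) (f x)) T.eval
/-- The value of an edge: a leaf is evaluated to the unit, an internal edge of type `ω` to the
image under `P ω` of the value of the tree it carries. -/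
def evalBranch : Branch Ω (PTree X Ω) → A
  | .leaf => one
  | .edge ω T => P ω T.eval
end

/-- The linear extension of `PTree.eval` to `k𝒯`. -/
def PTree.evalₗ : (PTree X Ω →₀ k) →ₗ[k] A :=
  Finsupp.linearCombination k (PTree.eval mul one P f)

namespace PTree

@[simp]
theorem evalₗ_single (T : PTree X Ω) :
    evalₗ mul one P f (Finsupp.single T 1) = T.eval mul one P f := by
  simp [evalₗ]

theorem evalₗ_unitTree : evalₗ mul one P f (unitTree k) = one := by
  simp [unitTree, eval, evalBranch]

theorem evalₗ_Bplus (ω : Ω) (a : PTree X Ω →₀ k) :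
    evalₗ mul one P f (Bplus k ω a) = P ω (evalₗ mul one P f a) := by
  refine LinearMap.congr_fun (f := evalₗ mul one P f ∘ₗ Bplus k ω)
    (g := P ω ∘ₗ evalₗ mul one P f) (ext_single fun T => ?_) a
  simp [graft, eval, evalBranch]

variable [Semigroup Ω] {lam : k} {mul one P}

theorem evalₗ_genTree (h : IsRotaBaxterFamilyAlgebra lam mul one P) (x : X) :
    evalₗ mul one P f (genTree k x) = f x := by
  simp [genTree, eval, evalBranch, h.one_mul, h.mul_one]

theorem eval_join (h : IsRotaBaxterFamilyAlgebra lam mul one P) (x : X) (T U : PTree X Ω) :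
    (T.join x U).eval mul one P f =
      mul (mul (T.eval mul one P f) (f x)) (U.eval mul one P f) := by
  induction T using induction_on with
  | leaf => simp only [join, eval]
  | graft => simp only [PTree.graft, join, eval]
  | cons _ _ _ _ ih => simp only [join, eval, ih, h.assoc]

theorem evalₗ_joinₗ (h : IsRotaBaxterFamilyAlgebra lam mul one P) (x : X)
    (a b : PTree X Ω →₀ k) :
    evalₗ mul one P f (joinₗ x a b) =
      mul (mul (evalₗ mul one P f a) (f x)) (evalₗ mul one P f b) := by
  refine map_bilin_of_single (g := mul ∘ₗ mul.flip (f x)) (fun T U => ?_) a b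
  simp [eval_join f h]

theorem evalₗ_diamond_single (h : IsRotaBaxterFamilyAlgebra lam mul one P) (T U : PTree X Ω) :
    evalₗ mul one P f (diamond k lam (Finsupp.single T 1) (Finsupp.single U 1)) =
      mul (evalₗ mul one P f (Finsupp.single T 1)) (evalₗ mul one P f (Finsupp.single U 1)) := by
  match T, U with
  | .cons b x T, U =>
    simp only [single_cons, diamond_joinₗ_left, evalₗ_joinₗ f h, evalₗ_diamond_single h T U,
      h.assoc]
  | T, .cons b x U =>
    simp only [single_cons, diamond_joinₗ_right, evalₗ_joinₗ f h,
      evalₗ_diamond_single h T (.last b), h.assoc]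
  | .last .leaf, U => simp only [single_last_leaf, unitTree_diamond, evalₗ_unitTree, h.one_mul]
  | T, .last .leaf => simp only [single_last_leaf, diamond_unitTree, evalₗ_unitTree, h.mul_one]
  | .last (.edge α S), .last (.edge β V) =>
    have h₁ := evalₗ_diamond_single h (.last (.edge α S)) V
    have h₂ := evalₗ_diamond_single h S (.last (.edge β V))
    have h₃ := evalₗ_diamond_single h S V
    simp only [single_last_edge, evalₗ_Bplus] at *
    rw [Bplus_diamond_Bplus, evalₗ_Bplus, h.rota_baxter]
    simp only [map_add, map_smul, h₁, h₂, h₃]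
termination_by sizeOf T + sizeOf U
decreasing_by all_goals (simp; try omega)

theorem evalₗ_diamond (h : IsRotaBaxterFamilyAlgebra lam mul one P) (a b : PTree X Ω →₀ k) :
    evalₗ mul one P f (diamond k lam a b) =
      mul (evalₗ mul one P f a) (evalₗ mul one P f b) :=
  map_bilin_of_single (evalₗ_diamond_single f h) a b

theorem eq_evalₗ {F : (PTree X Ω →₀ k) →ₗ[k] A} (h_one : F (unitTree k) = one)
    (h_mul : ∀ a b, F (diamond k lam a b) = mul (F a) (F b))
    (h_P : ∀ ω a, F (Bplus k ω a) = P ω (F a)) (h_gen : ∀ x, F (genTree k x) = f x) :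
    F = evalₗ mul one P f := by
  refine ext_single fun T => ?_
  rw [evalₗ_single]
  induction T using induction_on with
  | leaf => rw [single_last_leaf, h_one, eval, evalBranch]
  | graft ω T ih => rw [graft, single_last_edge, h_P, ih, eval, evalBranch]
  | cons b x T hb ih =>
    rw [single_cons, joinₗ_eq_diamond lam, h_mul, h_mul, hb, ih, h_gen, eval, eval]

end PTree

theorem isFreeRotaBaxterFamilyAlgebra_diamond [Semigroup Ω] (lam : k) :
    IsFreeRotaBaxterFamilyAlgebra.{w} lam (diamond k (X := X) (Ω := Ω) lam) (unitTree k)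
      (Bplus k) (genTree k) :=
  ⟨isRotaBaxterFamilyAlgebra_diamond lam, fun _ _ _ mul one P h f =>
    ⟨PTree.evalₗ mul one P f,
      ⟨PTree.evalₗ_unitTree mul one P f, PTree.evalₗ_diamond f h, PTree.evalₗ_Bplus mul one P f,
        PTree.evalₗ_genTree f h⟩,
      fun _ ⟨h_one, h_mul, h_P, h_gen⟩ => PTree.eq_evalₗ f h_one h_mul h_P h_gen⟩⟩

end FreeRotaBaxter

section NodeHom

variable {k : Type*} [CommRing k] {X Ω : Type*} {E : Type*} [AddCommGroup E] [Module k E]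
  {p s : Ω → E →ₗ[k] E →ₗ[k] E} {F : (BTree X Ω →₀ k) →ₗ[k] E}

/-- A linear map `F` on `kY` with `F (Tˡ ∨ Tʳ) = p_β (F (Tˡ ∨ |)) (F Tʳ)` if `Tʳ` sits on an edge
of type `β`, and `F (Tˡ ∨ Tʳ) = s_α (F Tˡ) (F (| ∨ Tʳ))` if `Tˡ` sits on an edge of type `α`. It
is the part of being a homomorphism that does not involve the recursion for `≺` and `≻`. -/
structure IsNodeHom (p s : Ω → E →ₗ[k] E →ₗ[k] E) (F : (BTree X Ω →₀ k) →ₗ[k] E) : Prop where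
  map_right : ∀ l x β R, F (Finsupp.single (.node l x (.edge β R)) 1) =
    p β (F (Finsupp.single (.node l x .leaf) 1)) (F (Finsupp.single R 1))
  map_left : ∀ α L x r, F (Finsupp.single (.node (.edge α L) x r) 1) =
    s α (F (Finsupp.single L 1)) (F (Finsupp.single (.node .leaf x r) 1))

theorem IsNodeHom.map_mapDomain_right (hF : IsNodeHom p s F) (l : Branch Ω (BTree X Ω)) (x : X)
    (β : Ω) (u : BTree X Ω →₀ k) :
    F (u.mapDomain fun R => .node l x (.edge β R)) =
      p β (F (Finsupp.single (.node l x .leaf) 1)) (F u) := by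
  refine LinearMap.congr_fun (f := F ∘ₗ Finsupp.lmapDomain k k fun R => .node l x (.edge β R))
    (g := p β (F (Finsupp.single (.node l x .leaf) 1)) ∘ₗ F) (ext_single fun R => ?_) u
  simp [hF.map_right]

theorem IsNodeHom.map_mapDomain_left (hF : IsNodeHom p s F) (α : Ω) (x : X)
    (r : Branch Ω (BTree X Ω)) (u : BTree X Ω →₀ k) :
    F (u.mapDomain fun L => .node (.edge α L) x r) =
      s α (F u) (F (Finsupp.single (.node .leaf x r) 1)) := by
  refine LinearMap.congr_fun (f := F ∘ₗ Finsupp.lmapDomain k k fun L => .node (.edge α L) x r)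
    (g := (s α).flip (F (Finsupp.single (.node .leaf x r) 1)) ∘ₗ F) (ext_single fun L => ?_) u
  simp [hF.map_left]

variable [Semigroup Ω]

@[simp]
theorem prec_single (ω : Ω) (T U : BTree X Ω) :
    prec k ω (Finsupp.single T 1) (Finsupp.single U 1) = precTree k ω T U := by
  simp [prec]

@[simp]
theorem succ_single (ω : Ω) (T U : BTree X Ω) :
    succ k ω (Finsupp.single T 1) (Finsupp.single U 1) = succTree k ω T U := by
  simp [succ]

mutual
theorem IsNodeHom.map_precTree (hF : IsNodeHom p s F) (h : IsDendriformFamilyAlgebra p s) (ω : Ω) :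
    ∀ T U : BTree X Ω,
      F (precTree k ω T U) = p ω (F (Finsupp.single T 1)) (F (Finsupp.single U 1))
  | .node l x .leaf, U => by rw [precTree, hF.map_right]
  | .node l x (.edge α R), U => by
    rw [precTree, hF.map_mapDomain_right, map_add, hF.map_precTree h ω R U,
      hF.map_succTree h α R U, hF.map_right, h.prec_prec]
termination_by T U => sizeOf T + sizeOf U
theorem IsNodeHom.map_succTree (hF : IsNodeHom p s F) (h : IsDendriformFamilyAlgebra p s) (ω : Ω) :
    ∀ T U : BTree X Ω,
      F (succTree k ω T U) = s ω (F (Finsupp.single T 1)) (F (Finsupp.single U 1))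
  | T, .node .leaf y r => by rw [succTree, hF.map_left]
  | T, .node (.edge β L) y r => by
    rw [succTree, hF.map_mapDomain_left, map_add, hF.map_precTree h β T L,
      hF.map_succTree h ω T L, hF.map_left, h.succ_succ]
termination_by T U => sizeOf T + sizeOf U
end

theorem IsNodeHom.isDendriformFamilyHom (hF : IsNodeHom p s F)
    (h : IsDendriformFamilyAlgebra p s) : IsDendriformFamilyHom (prec k) (succ k) p s F where
  map_prec ω := map_bilin_of_single (by simpa using hF.map_precTree h ω)
  map_succ ω := map_bilin_of_single (by simpa using hF.map_succTree h ω)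

end NodeHom

section Inclusion

variable {k : Type*} [CommRing k] {X Ω : Type*}

@[simp]
theorem incl_single (T : BTree X Ω) :
    incl k (Finsupp.single T 1) = Finsupp.single T.toPTree 1 := by
  simp [incl]

theorem incl_injective : Function.Injective (incl k (X := X) (Ω := Ω)) :=
  Finsupp.mapDomain_injective fun _ _ => BTree.toPTree_injective

theorem range_incl : LinearMap.range (incl k (X := X) (Ω := Ω)) = binarySpan k X Ω := by
  rw [incl, Finsupp.range_lmapDomain, binarySpan, ← BTree.range_toPTree, ← Set.range_comp]
  rfl

theorem incl_genBTree (x : X) : incl k (Ω := Ω) (genBTree k x) = genTree k x := by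
  simp [genBTree, genTree, BTree.toPTree, branchToPTree]

variable [Semigroup Ω]

theorem isNodeHom_incl (lam : k) :
    IsNodeHom (inducedPrec k (diamond k (X := X) (Ω := Ω) lam) (Bplus k))
      (inducedSucc k (diamond k lam) (Bplus k)) (incl k) where
  map_right l x β R := by
    simp only [incl_single, BTree.toPTree, branchToPTree, single_cons, single_last_edge,
      single_last_leaf, inducedPrec, LinearMap.compl₂_apply, diamond_joinₗ_left, unitTree_diamond]
  map_left α L x r := by
    simp only [incl_single, BTree.toPTree, branchToPTree, single_cons, single_last_edge,
      single_last_leaf, inducedSucc, LinearMap.comp_apply, diamond_joinₗ_right, diamond_unitTree]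

theorem isDendriformFamilyAlgebra_induced :
    IsDendriformFamilyAlgebra (inducedPrec k (diamond k (X := X) (Ω := Ω) 0) (Bplus k))
      (inducedSucc k (diamond k 0) (Bplus k)) :=
  (isRotaBaxterFamilyAlgebra_diamond 0).isDendriformFamilyAlgebra

theorem isDendriformFamilyHom_incl :
    IsDendriformFamilyHom (prec k) (succ k)
      (inducedPrec k (diamond k (X := X) (Ω := Ω) 0) (Bplus k))
      (inducedSucc k (diamond k 0) (Bplus k)) (incl k) :=
  (isNodeHom_incl 0).isDendriformFamilyHom isDendriformFamilyAlgebra_induced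

theorem isDendriformFamilySubalgebra_binarySpan :
    IsDendriformFamilySubalgebra
      (inducedPrec k (diamond k (X := X) (Ω := Ω) 0) (Bplus k))
      (inducedSucc k (diamond k 0) (Bplus k)) (binarySpan k X Ω) :=
  range_incl (k := k) ▸
    isDendriformFamilyHom_incl.isDendriformFamilySubalgebra_range isDendriformFamilyAlgebra_induced

theorem isDendriformFamilyAlgebra_prec_succ :
    IsDendriformFamilyAlgebra (prec k (X := X) (Ω := Ω)) (succ k) :=
  isDendriformFamilyAlgebra_induced.of_injective incl_injective isDendriformFamilyHom_incl

end Inclusion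

section FreeDendriform

variable {k : Type*} [CommRing k] {X Ω : Type*} {E : Type*} [AddCommGroup E] [Module k E]
  (p s : Ω → E →ₗ[k] E →ₗ[k] E) (f : X → E)

/-- The value of a binary tree in a module with two families of bilinear operations, for given
values of the angle decorations. -/
def BTree.eval : BTree X Ω → E
  | .node .leaf x .leaf => f x
  | .node (.edge α L) x .leaf => s α L.eval (f x)
  | .node l x (.edge β R) => p β (eval (.node l x .leaf)) R.eval
termination_by T => sizeOf T
decreasing_by all_goals (simp; try omega)

/-- The linear extension of `BTree.eval` to `kY`. -/
def BTree.evalₗ : (BTree X Ω →₀ k) →ₗ[k] E :=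
  Finsupp.linearCombination k (BTree.eval p s f)

namespace BTree

@[simp]
theorem evalₗ_single (T : BTree X Ω) :
    evalₗ p s f (Finsupp.single T 1) = T.eval p s f := by
  simp [evalₗ]

theorem evalₗ_genBTree (x : X) : evalₗ p s f (genBTree k x) = f x := by
  simp [genBTree, eval]

variable [Semigroup Ω] {p s}

theorem isNodeHom_evalₗ (h : IsDendriformFamilyAlgebra p s) :
    IsNodeHom p s (evalₗ (X := X) p s f) where
  map_right l x β R := by simp only [evalₗ_single, eval]
  map_left α L x r := by cases r <;> simp only [evalₗ_single, eval, h.succ_prec]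

theorem eq_evalₗ {F : (BTree X Ω →₀ k) →ₗ[k] E}
    (hF : IsDendriformFamilyHom (prec k) (succ k) p s F) (h_gen : ∀ x, F (genBTree k x) = f x) :
    F = evalₗ p s f := by
  refine ext_single fun T => ?_
  rw [evalₗ_single]
  induction T using induction_on with
  | gen x => rw [eval, ← h_gen, genBTree]
  | left α L x ih => rw [eval, ← ih, ← h_gen, ← hF.map_succ, genBTree, succ_single, succTree]
  | right l x β R ihl ihR => rw [eval, ← ihl, ← ihR, ← hF.map_prec, prec_single, precTree]

end BTree

theorem isFreeDendriformFamilyAlgebra_prec_succ [Semigroup Ω] :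
    IsFreeDendriformFamilyAlgebra.{w} (prec k (X := X) (Ω := Ω)) (succ k) (genBTree k) :=
  ⟨isDendriformFamilyAlgebra_prec_succ, fun _ _ _ p s h f =>
    ⟨BTree.evalₗ p s f,
      ⟨(BTree.isNodeHom_evalₗ f h).isDendriformFamilyHom h, BTree.evalₗ_genBTree p s f⟩,
      fun _ ⟨hom, h_gen⟩ => BTree.eq_evalₗ f hom h_gen⟩⟩

end FreeDendriform

end

end FamilyTrees

theorem theorem3p4 (k : Type*) [CommRing k] (X Ω : Type*) [Semigroup Ω] :
    -- `(k𝒯, ⋄, B⁺)` is the free Rota–Baxter family algebra of weight `0` on `X`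
    FamilyTrees.IsFreeRotaBaxterFamilyAlgebra.{w} (0 : k)
      (FamilyTrees.diamond k (X := X) (Ω := Ω) 0) (FamilyTrees.unitTree k)
      (FamilyTrees.Bplus k) (FamilyTrees.genTree k) ∧
    -- the span of the binary trees, with `≺_ω` and `≻_ω` defined recursively, is the free
    -- dendriform family algebra on `X`
    FamilyTrees.IsFreeDendriformFamilyAlgebra.{w} (FamilyTrees.prec k (X := X) (Ω := Ω))
      (FamilyTrees.succ k) (FamilyTrees.genBTree k) ∧
    -- the natural inclusion identifies it with the submodule of `k𝒯` spanned by the binary trees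
    Function.Injective (FamilyTrees.incl k (X := X) (Ω := Ω)) ∧
    LinearMap.range (FamilyTrees.incl k (X := X) (Ω := Ω)) = FamilyTrees.binarySpan k X Ω ∧
    (∀ x : X, FamilyTrees.incl k (Ω := Ω) (FamilyTrees.genBTree k x) =
      FamilyTrees.genTree k x) ∧
    -- this submodule is a dendriform family subalgebra of `k𝒯` with the induced operations
    FamilyTrees.IsDendriformFamilySubalgebra
      (FamilyTrees.inducedPrec k (FamilyTrees.diamond k (X := X) (Ω := Ω) 0)
        (FamilyTrees.Bplus k))
      (FamilyTrees.inducedSucc k (FamilyTrees.diamond k (X := X) (Ω := Ω) 0)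
        (FamilyTrees.Bplus k))
      (FamilyTrees.binarySpan k X Ω) ∧
    -- and the inclusion carries the recursive operations to the induced ones
    (∀ (ω : Ω) (a b : FamilyTrees.BTree X Ω →₀ k),
      FamilyTrees.incl k (FamilyTrees.prec k ω a b) =
        FamilyTrees.diamond k 0 (FamilyTrees.incl k a)
          (FamilyTrees.Bplus k ω (FamilyTrees.incl k b)) ∧
      FamilyTrees.incl k (FamilyTrees.succ k ω a b) =
        FamilyTrees.diamond k 0 (FamilyTrees.Bplus k ω (FamilyTrees.incl k a))
          (FamilyTrees.incl k b)) := by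
  exact ⟨FamilyTrees.isFreeRotaBaxterFamilyAlgebra_diamond 0,
    FamilyTrees.isFreeDendriformFamilyAlgebra_prec_succ, FamilyTrees.incl_injective,
    FamilyTrees.range_incl, FamilyTrees.incl_genBTree,
    FamilyTrees.isDendriformFamilySubalgebra_binarySpan,
    fun ω a b => ⟨FamilyTrees.isDendriformFamilyHom_incl.map_prec ω a b,
      FamilyTrees.isDendriformFamilyHom_incl.map_succ ω a b⟩⟩
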